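/- Let $K:\mathbb R^d\times\mathbb R^d\to\mathbb R$ be a twice continuously differentiable, symmetric, positive semidefinite kernel (for instance the squared exponential kernel), let $\sigma>0$, and let $X\subseteq\mathbb R^d$ be a set on which derivatives within $X$ are uniquely determined at every point (for instance an open set, or a convex set with non-empty interior). Let $\mu$ be a finite measure, and suppose that $K$ has a Mercer eigenexpansion on $X$: there are a finite or infinite family of eigenvalues $\lambda_s\ge 0$ and eigenfunctions $\phi_s$, orthonormal in $L^2(X,\mu)$, with $\int_X K(x,y)\phi_s(y)\,d\mu(y)=\lambda_s\phi_s(x)$ for $x\in X$, such that $$K(x,y)=\sum_s\lambda_s\phi_s(x)\phi_s(y)\qquad(x,y\in X).$$ For points $x_1,\dots,x_N\in\mathbb R^d$ let $\tilde{\mathbf K}(x_{1:N})$ be the $N(1+d)\times N(1+d)$ matrix whose entries are the values $K(x_i,x_{i'})$, the first partial derivatives of $K$ in either argument and the mixed derivatives $\partial_{x_j}\partial_{y_{j'}}K$ (one derivative in each argument), at all pairs $(x_i,x_{i'})$. This is the covariance matrix of a Gaussian process and its gradient at these points. The information gain with derivatives is $\widetilde{IG}(x_{1:N})=\tfrac12\log\det(\mathbf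 I+\sigma^{-2}\tilde{\mathbf K}(x_{1:N}))$. For batch size $n$ and $t$ rounds put $N_t=nt$ and let $$\tilde\gamma_t=\sup_{A\subseteq X,\ |A|=N_t}\widetilde{IG}(A)\in[-\infty,\infty]$$ be the maximum information gain with derivatives. Put $$\tilde\phi_s(x)^2:=\phi_s(x)^2+\sum_{j=1}^d\Big(\frac{\partial\phi_s}{\partial x_j}(x)\Big)^2,\qquad c:=(1-e^{-1})^{-1},\qquad B(x_{1:N}):=\frac c2\sum_s\log\Big(1+\sigma^{-2}\lambda_s\sum_{i=1}^{N}\tilde\phi_s(x_i)^2\Big),$$ where the partial derivatives of $\phi_s$ are taken within $X$. Then: 1. the series defining $B(x_{1:N})$ converges for all $N$ and all $x_1,\dots,x_N\in X$; 2. $\widetilde{IG}(A)\le B(A)$ for every $A\subseteq X$ with $|A|=N_t$; 3. $\tilde\gamma_t\le B(A)$ whenever $A=\{x_1,\dots,x_{N_t}\}\subseteq X$ attains the maximum $\tilde\gamma_t$; 4. $\tilde\gamma_t\le B(x_{1:N_t})$ also when $x_{1:N_t}$ is collected greedily in $t$ batches of $n$ points of $X$ (repetitions allowed), that is, when each batch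 maximizes, over all $n$-tuples of points of $X$ and given the earlier batches, the information gain $\widetilde{IG}$ of all points collected so far. -/

import Mathlib

open MeasureTheory

namespace GPD

/-- The input space `ℝ^d` with its Euclidean norm. -/
abbrev Pt (d : ℕ) : Type := EuclideanSpace ℝ (Fin d)

/-- A real covariance function on `ℝ^d`: every matrix `(K (x i) (x j))` is symmetric and
positive semidefinite. -/
def IsPSDKernel {d : ℕ} (K : Pt d → Pt d → ℝ) : Prop :=
  ∀ (m : ℕ) (x : Fin m → Pt d), (Matrix.of fun i j => K (x i) (x j)).PosSemidef

/-- The value (`none`) or the `j`-th partial derivative (`some j`) of `f`. -/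
noncomputable def valueOrPartial {d : ℕ} (a : Option (Fin d)) (f : Pt d → ℝ) (x : Pt d) : ℝ :=
  match a with
  | none => f x
  | some j => fderiv ℝ f x (EuclideanSpace.single j 1)

/-- The extended covariance matrix of the values and of all the first partial derivatives at the
points `x i`. Its entry at `((i, a), (j, b))` is the kernel, differentiated in its first argument
as `a` says and in its second argument as `b` says, at `(x i, x j)`. -/
noncomputable def extCov {d : ℕ} (K : Pt d → Pt d → ℝ) {κ : Type*} (x : κ → Pt d) :
    Matrix (κ × Option (Fin d)) (κ × Option (Fin d)) ℝ :=
  Matrix.of fun p q =>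
    valueOrPartial p.2 (fun u => valueOrPartial q.2 (fun v => K u v) (x q.1)) (x p.1)

open Classical in
/-- The information gain `(1/2) log det (I + σ⁻² K̃)` of observing, with Gaussian noise of
variance `σ²`, the values and the gradients at the points `x i`. -/
noncomputable def infoGain {d : ℕ} (K : Pt d → Pt d → ℝ) (σ : ℝ) {κ : Type*} [Fintype κ]
    (x : κ → Pt d) : ℝ :=
  (1 / 2) * Real.log (1 + (σ ^ 2)⁻¹ • extCov K x).det

/-- The information gain of a finite set of points. -/
noncomputable def infoGainSet {d : ℕ} (K : Pt d → Pt d → ℝ) (σ : ℝ) (A : Finset (Pt d)) : ℝ :=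
  infoGain K σ (fun a : A => (a : Pt d))

/-- The maximum information gain (with derivatives) over the sets of `N` points of `X`. -/
noncomputable def maxInfoGain {d : ℕ} (K : Pt d → Pt d → ℝ) (σ : ℝ) (X : Set (Pt d)) (N : ℕ) :
    EReal :=
  ⨆ A : {A : Finset (Pt d) // (A : Set (Pt d)) ⊆ X ∧ A.card = N}, (infoGainSet K σ A.1 : EReal)

/-- A Mercer eigenexpansion of `K` on `X` for the measure `μ` on `X`: eigenvalues `lam s ≥ 0` and
orthonormal eigenfunctions `φ s` of the integral operator with kernel `K`, such that
`K x y = ∑ lam s * φ s x * φ s y` on `X × X`. The index type may be finite or infinite. -/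
structure IsMercerExpansion {d : ℕ} (X : Set (Pt d)) (μ : Measure (Pt d)) (K : Pt d → Pt d → ℝ)
    {S : Type*} (lam : S → ℝ) (φ : S → Pt d → ℝ) : Prop where
  nonneg : ∀ s, 0 ≤ lam s
  memLp : ∀ s, MemLp (φ s) 2 (μ.restrict X)
  norm_one : ∀ s, ∫ x in X, φ s x * φ s x ∂μ = 1
  orthogonal : ∀ s r, s ≠ r → ∫ x in X, φ s x * φ r x ∂μ = 0
  integrable : ∀ s, ∀ x ∈ X, Integrable (fun y => K x y * φ s y) (μ.restrict X)
  eigen : ∀ s, ∀ x ∈ X, ∫ y in X, K x y * φ s y ∂μ = lam s * φ s x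
  expansion : ∀ x ∈ X, ∀ y ∈ X, HasSum (fun s => lam s * φ s x * φ s y) (K x y)

/-- `φ̃(x)²`: the square of `φ` plus the squares of its first partial derivatives at `x`. The
function `φ` matters on the domain `X` only, so the derivatives are taken within `X`; at interior
points of `X` they are the usual ones. -/
noncomputable def extSq {d : ℕ} (X : Set (Pt d)) (φ : Pt d → ℝ) (x : Pt d) : ℝ :=
  (φ x) ^ 2 + ∑ j : Fin d, (fderivWithin ℝ φ X x (EuclideanSpace.single j 1)) ^ 2

/-- The `s`-th term `log (1 + σ⁻² lam s ∑ i, φ̃ s (x i)²)` of the bound. -/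
noncomputable def boundTerm {d : ℕ} (X : Set (Pt d)) (σ : ℝ) {S : Type*} (lam : S → ℝ)
    (φ : S → Pt d → ℝ) {κ : Type*} [Fintype κ] (x : κ → Pt d) (s : S) : ℝ :=
  Real.log (1 + (σ ^ 2)⁻¹ * lam s * ∑ i, extSq X (φ s) (x i))

/-- The bound `(c/2) ∑ s, log (1 + σ⁻² lam s ∑ i, φ̃ s (x i)²)` with `c = (1 - e⁻¹)⁻¹`. -/
noncomputable def mercerBound {d : ℕ} (X : Set (Pt d)) (σ : ℝ) {S : Type*} (lam : S → ℝ)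
    (φ : S → Pt d → ℝ) {κ : Type*} [Fintype κ] (x : κ → Pt d) : ℝ :=
  (1 - Real.exp (-1))⁻¹ / 2 * ∑' s, boundTerm X σ lam φ x s

/-- `x` consists of `t` batches of `n` points of `X`, where each batch maximizes, given the earlier
ones, the information gain reached after it. -/
def IsGreedy {d : ℕ} (K : Pt d → Pt d → ℝ) (σ : ℝ) (X : Set (Pt d)) {n t : ℕ}
    (x : Fin t → Fin n → Pt d) : Prop :=
  (∀ τ i, x τ i ∈ X) ∧
    ∀ (τ : Fin t) (z : Fin n → Pt d), (∀ i, z i ∈ X) →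
      infoGain K σ (fun p : {r : Fin t // r ≤ τ} × Fin n =>
          Function.update x τ z p.1.1 p.2) ≤
        infoGain K σ (fun p : {r : Fin t // r ≤ τ} × Fin n => x p.1.1 p.2)

end GPD

/-! The argument writes the extended covariance as a convergent sum of rank-one matrices, one for
each eigenfunction, and then uses submodularity of `log det`.

Write `K x y = ⟪k x, k y⟫` in a Hilbert space. Since `K` is C², `k` is differentiable
(`differentiable_of_contDiff_inner`), so the derivatives of `K` are inner products of derivatives of
`k`. On `X` the Mercer series gives a second feature map, `x ↦ (√(lam s) * φ s x)` into `ℓ²`, with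
the same inner products. Hence a continuous linear `T` carries `k` to it, and `T` also respects the
derivatives of `k`, because these are determined by the values on `X`. The coordinates of `T (∂ⱼ k
x)` are `√(lam s) * ∂ⱼ φ s x`, so the series for the derivatives of `K` follows without
differentiating termwise (`exists_extCov_features`).

By `log_det_submodular` the information gain is at most the sum of the gains of the rank-one terms,
which is the bound with constant 1 instead of `c ≥ 1`. The factor `c` is needed only for greedy
points: submodularity in the points gives them at least `1 - e⁻¹` of the gain of any competing set
(`log_det_le_of_greedy`), and their own gain is bounded with constant 1. -/

namespace GPD

/-! ### Submodularity of the log-determinant -/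

section LogDet

open Matrix

variable {m : Type*} [Fintype m]

lemma dotProduct_mulVec_comm_of_isSymm {W : Matrix m m ℝ} (hW : W.IsHermitian) (u v : m → ℝ) :
    u ⬝ᵥ W *ᵥ v = v ⬝ᵥ W *ᵥ u := by
  have h : Wᵀ = W := by rw [← conjTranspose_eq_transpose_of_trivial]; exact hW
  rw [dotProduct_mulVec, ← mulVec_transpose, h, dotProduct_comm]

lemma posSemidef_vecMulVec (v : m → ℝ) : (vecMulVec v v).PosSemidef := by
  simpa using posSemidef_vecMulVec_self_star v

lemma exists_eq_sum_vecMulVec {R : Matrix m m ℝ} (hR : R.PosSemidef) :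
    ∃ (N : ℕ) (v : Fin N → m → ℝ), R = ∑ i, vecMulVec (v i) (v i) := by
  simpa using posSemidef_iff_eq_sum_vecMulVec.1 hR

lemma posSemidef_sum_vecMulVec {ι : Type*} (s : Finset ι) (v : ι → m → ℝ) :
    (∑ i ∈ s, vecMulVec (v i) (v i)).PosSemidef :=
  posSemidef_sum s fun i _ => posSemidef_vecMulVec (v i)

variable [DecidableEq m]

/-- The variational bound for the inverse of a positive definite matrix. -/
lemma two_mul_sub_le_dotProduct_inv_mulVec {W : Matrix m m ℝ} (hW : W.PosDef) (v a : m → ℝ) :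
    2 * (a ⬝ᵥ v) - a ⬝ᵥ W *ᵥ a ≤ v ⬝ᵥ W⁻¹ *ᵥ v := by
  set b := W⁻¹ *ᵥ v with hb
  have hWb : W *ᵥ b = v := by
    rw [hb, mulVec_mulVec, mul_nonsing_inv _ ((isUnit_iff_isUnit_det W).1 hW.isUnit), one_mulVec]
  -- Completing the square: the gap in the inequality is the quadratic form of `W` at `a - b`.
  have h := hW.posSemidef.dotProduct_mulVec_nonneg (a - b)
  have hs := dotProduct_mulVec_comm_of_isSymm hW.1 b a
  simp only [star_trivial, mulVec_sub, hWb, sub_dotProduct, dotProduct_sub] at h hs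
  rw [dotProduct_comm v b]
  have : b ⬝ᵥ W *ᵥ a = a ⬝ᵥ v := by rw [dotProduct_mulVec_comm_of_isSymm hW.1, hWb]
  linarith

/-- Inserting the maximizer for `W + Q` into the variational bound for `W` only gains the
nonnegative term `a ⬝ᵥ Q *ᵥ a`. -/
lemma dotProduct_inv_add_mulVec_le {W Q : Matrix m m ℝ} (hW : W.PosDef) (hQ : Q.PosSemidef)
    (v : m → ℝ) : v ⬝ᵥ (W + Q)⁻¹ *ᵥ v ≤ v ⬝ᵥ W⁻¹ *ᵥ v := by
  have hWQ : (W + Q).PosDef := hW.add_posSemidef hQ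
  set a := (W + Q)⁻¹ *ᵥ v with ha
  have hWa : (W + Q) *ᵥ a = v := by
    rw [ha, mulVec_mulVec, mul_nonsing_inv _ ((isUnit_iff_isUnit_det _).1 hWQ.isUnit), one_mulVec]
  have h1 := two_mul_sub_le_dotProduct_inv_mulVec hW v a
  have h2 := hQ.dotProduct_mulVec_nonneg a
  have h3 : a ⬝ᵥ W *ᵥ a + a ⬝ᵥ Q *ᵥ a = a ⬝ᵥ v := by
    rw [← dotProduct_add, ← add_mulVec, hWa]
  rw [star_trivial] at h2
  rw [dotProduct_comm v a]
  linarith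

lemma det_add_vecMulVec {W : Matrix m m ℝ} (hW : W.PosDef) (v : m → ℝ) :
    (W + vecMulVec v v).det = W.det * (1 + v ⬝ᵥ W⁻¹ *ᵥ v) := by
  rw [vecMulVec_eq Unit,
    det_add_replicateCol_mul_replicateRow ((isUnit_iff_isUnit_det W).1 hW.isUnit)]
  simp [det_unique, Matrix.mul_assoc, Matrix.mul_apply, dotProduct, mulVec]

lemma dotProduct_inv_mulVec_nonneg {W : Matrix m m ℝ} (hW : W.PosDef) (v : m → ℝ) :
    0 ≤ v ⬝ᵥ W⁻¹ *ᵥ v := by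
  simpa using hW.inv.posSemidef.dotProduct_mulVec_nonneg v

lemma log_det_add_vecMulVec {W : Matrix m m ℝ} (hW : W.PosDef) (v : m → ℝ) :
    Real.log (W + vecMulVec v v).det =
      Real.log W.det + Real.log (1 + v ⬝ᵥ W⁻¹ *ᵥ v) := by
  have := dotProduct_inv_mulVec_nonneg hW v
  rw [det_add_vecMulVec hW, Real.log_mul hW.det_pos.ne' (by positivity)]

/-- The logarithm of the determinant is submodular on positive definite matrices. -/
lemma log_det_submodular {W Q R : Matrix m m ℝ} (hW : W.PosDef) (hQ : Q.PosSemidef)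
    (hR : R.PosSemidef) :
    Real.log (W + Q + R).det + Real.log W.det ≤
      Real.log (W + Q).det + Real.log (W + R).det := by
  -- Adding `R` one rank-one term at a time, each gain is `log (1 + vᵀ(·)⁻¹v)`, which the presence
  -- of `Q` can only decrease.
  obtain ⟨N, v, rfl⟩ := exists_eq_sum_vecMulVec hR
  generalize (Finset.univ : Finset (Fin N)) = s
  induction s using Finset.induction_on with
  | empty => simp
  | insert i s hi ih =>
    have hs := posSemidef_sum_vecMulVec s v
    have h1 : (W + ∑ i ∈ s, vecMulVec (v i) (v i)).PosDef := hW.add_posSemidef hs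
    have h2 : (W + Q + ∑ i ∈ s, vecMulVec (v i) (v i)).PosDef :=
      (hW.add_posSemidef hQ).add_posSemidef hs
    have h3 := dotProduct_inv_add_mulVec_le h1 hQ (v i)
    rw [add_right_comm] at h3
    have h4 := dotProduct_inv_mulVec_nonneg h2 (v i)
    have h5 := Real.log_le_log (by positivity) (add_le_add_right h3 1)
    rw [Finset.sum_insert hi, add_comm (vecMulVec _ _), ← add_assoc, ← add_assoc,
      log_det_add_vecMulVec h1, log_det_add_vecMulVec h2]
    linarith

lemma log_det_le_log_det_add {W R : Matrix m m ℝ} (hW : W.PosDef) (hR : R.PosSemidef) :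
    Real.log W.det ≤ Real.log (W + R).det := by
  obtain ⟨N, v, rfl⟩ := exists_eq_sum_vecMulVec hR
  generalize (Finset.univ : Finset (Fin N)) = s
  induction s using Finset.induction_on with
  | empty => simp
  | insert i s hi ih =>
    have h1 : (W + ∑ i ∈ s, vecMulVec (v i) (v i)).PosDef :=
      hW.add_posSemidef (posSemidef_sum_vecMulVec s v)
    rw [Finset.sum_insert hi, add_comm (vecMulVec _ _), ← add_assoc, log_det_add_vecMulVec h1]
    have := Real.log_nonneg (le_add_of_nonneg_right (dotProduct_inv_mulVec_nonneg h1 (v i)))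
    linarith

/-- Submodularity at `W = 1`: a rank-one term gains most when it is added to the identity alone. -/
lemma log_det_one_add_sum_vecMulVec_le {ι : Type*} (s : Finset ι) (v : ι → m → ℝ) :
    Real.log (1 + ∑ i ∈ s, vecMulVec (v i) (v i)).det ≤
      ∑ i ∈ s, Real.log (1 + v i ⬝ᵥ v i) := by
  classical
  induction s using Finset.induction_on with
  | empty => simp
  | insert i s hi ih =>
    have h1 := log_det_submodular (PosDef.one (n := m) (R := ℝ)) (posSemidef_sum_vecMulVec s v)
      (posSemidef_vecMulVec (v i))
    rw [log_det_add_vecMulVec PosDef.one (v i)] at h1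
    simp only [det_one, Real.log_one, inv_one, one_mulVec] at h1
    rw [Finset.sum_insert hi, Finset.sum_insert hi, add_comm (vecMulVec _ _), ← add_assoc]
    linarith

/-- The same bound for a convergent series of matrices of rank one. -/
lemma log_det_one_add_le_tsum {ι : Type*} {v : ι → m → ℝ} {R : Matrix m m ℝ}
    (hR : HasSum (fun i => vecMulVec (v i) (v i)) R)
    (hv : Summable fun i => Real.log (1 + v i ⬝ᵥ v i)) :
    Real.log (1 + R).det ≤ ∑' i, Real.log (1 + v i ⬝ᵥ v i) := by
  have hnn : ∀ u : m → ℝ, 0 ≤ u ⬝ᵥ u := fun u => by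
    simpa using dotProduct_star_self_nonneg u
  have h0 : ∀ i, 0 ≤ Real.log (1 + v i ⬝ᵥ v i) := fun i =>
    Real.log_nonneg (le_add_of_nonneg_right (hnn _))
  have hdet : Filter.Tendsto (fun s : Finset ι => (1 + ∑ i ∈ s, vecMulVec (v i) (v i)).det)
      Filter.atTop (nhds (1 + R).det) :=
    ((Continuous.matrix_det continuous_id).tendsto _).comp (tendsto_const_nhds.add hR)
  have hle : ∀ s : Finset ι, (1 + ∑ i ∈ s, vecMulVec (v i) (v i)).det ≤
      Real.exp (∑' i, Real.log (1 + v i ⬝ᵥ v i)) := fun s => by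
    have hp : (1 + ∑ i ∈ s, vecMulVec (v i) (v i)).PosDef :=
      PosDef.one.add_posSemidef (posSemidef_sum_vecMulVec s v)
    rw [← Real.log_le_iff_le_exp hp.det_pos]
    exact (log_det_one_add_sum_vecMulVec_le s v).trans (hv.sum_le_tsum s fun i _ => h0 i)
  have h := le_of_tendsto' hdet hle
  -- The limit is taken for determinants, since `log` is discontinuous at `0`. The nonpositive case
  -- is impossible because all partial determinants are at least `1`.
  rcases le_or_gt (1 + R).det 0 with hneg | hpos
  · have : ∀ s : Finset ι, 1 ≤ (1 + ∑ i ∈ s, vecMulVec (v i) (v i)).det := fun s => by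
      have hl := log_det_le_log_det_add (PosDef.one (n := m) (R := ℝ))
        (posSemidef_sum_vecMulVec s v)
      have hp : (1 + ∑ i ∈ s, vecMulVec (v i) (v i)).PosDef :=
        PosDef.one.add_posSemidef (posSemidef_sum_vecMulVec s v)
      rw [det_one] at hl
      exact (Real.log_le_log_iff one_pos hp.det_pos).1 hl
    linarith [ge_of_tendsto' hdet this]
  · rwa [Real.log_le_iff_le_exp hpos]

end LogDet

/-! ### Feature maps and maps between them -/

section FeatureMap

open Filter Topology
open scoped InnerProductSpace

/-- A positive semidefinite kernel has a feature map into a Hilbert space. -/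
lemma exists_featureMap {d : ℕ} {K : Pt d → Pt d → ℝ} (hK : IsPSDKernel K) :
    ∃ (H : Type) (_ : NormedAddCommGroup H) (_ : InnerProductSpace ℝ H) (_ : CompleteSpace H)
      (k : Pt d → H), ∀ x y, ⟪k x, k y⟫_ℝ = K x y := by
  have hsymm : ∀ x y, K x y = K y x := fun x y => by
    have h := (hK 2 ![x, y]).1.apply 1 0
    simpa using h
  let M : Matrix (Pt d) (Pt d) (ℝ →L[ℝ] ℝ) :=
    Matrix.of fun x y => K x y • 1
  have hM : M.PosSemidef := by
    have hiff := (RKHS.posSemidef_tfae (K := M)).out 0 2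
    refine hiff.2 ⟨?_, fun f => ?_⟩
    · ext x y
      simp [M, Matrix.conjTranspose_apply, hsymm y x]
    · have h := (hK f.support.card (fun i => (f.support.equivFin.symm i : Pt d))).dotProduct_mulVec_nonneg
        (fun i => f (f.support.equivFin.symm i))
      have hsum : ∀ g : Pt d → ℝ, ∑ i, g (f.support.equivFin.symm i) = ∑ x ∈ f.support, g x :=
        fun g => (Equiv.sum_comp f.support.equivFin.symm (fun x => g x)).trans
          (Finset.sum_coe_sort f.support g)
      simp only [dotProduct, Matrix.mulVec, star_trivial, Matrix.of_apply] at h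
      rw [hsum fun x => f x * ∑ i, K x (f.support.equivFin.symm i) * f (f.support.equivFin.symm i)]
        at h
      have h' : 0 ≤ ∑ x ∈ f.support, f x * ∑ y ∈ f.support, K x y * f y :=
        h.trans_eq (Finset.sum_congr rfl fun x _ => by rw [hsum fun y => K x y * f y])
      refine h'.trans_eq ?_
      change _ = ∑ x ∈ f.support, ∑ y ∈ f.support, ⟪(M y x) (f x), f y⟫_ℝ
      refine Finset.sum_congr rfl fun x _ => ?_
      rw [Finset.mul_sum]
      refine Finset.sum_congr rfl fun y _ => ?_
      change _ = ⟪K y x * f x, f y⟫_ℝ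
      rw [hsymm y x, Real.inner_apply]
      ring
  have : Fact M.PosSemidef := ⟨hM⟩
  refine ⟨RKHS.OfKernel M, inferInstance, inferInstance, inferInstance,
    fun x => RKHS.kerFun (RKHS.OfKernel M) x 1, fun x y => ?_⟩
  rw [← RKHS.kernel_inner, RKHS.OfKernel.kernel_ofKernel]
  simp [M, hsymm y x]

/-- Two families in Hilbert spaces with the same inner products are related by a continuous
linear map. -/
lemma exists_clm_of_inner_eq {ι H H' : Type*} [NormedAddCommGroup H] [InnerProductSpace ℝ H]
    [CompleteSpace H] [NormedAddCommGroup H'] [InnerProductSpace ℝ H'] [CompleteSpace H']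
    (a : ι → H) (b : ι → H') (h : ∀ i j, ⟪a i, a j⟫_ℝ = ⟪b i, b j⟫_ℝ) :
    ∃ T : H →L[ℝ] H', ∀ i, T (a i) = b i := by
  let A := Finsupp.linearCombination ℝ a
  let B := Finsupp.linearCombination ℝ b
  have hAB : ∀ f, ‖B f‖ = ‖A f‖ := fun f => by
    have : ⟪B f, B f⟫_ℝ = ⟪A f, A f⟫_ℝ := by
      simp only [A, B, Finsupp.linearCombination_apply, Finsupp.sum_inner, Finsupp.inner_sum,
        inner_smul_left, inner_smul_right, h]
    rw [real_inner_self_eq_norm_sq, real_inner_self_eq_norm_sq] at this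
    exact (sq_eq_sq₀ (norm_nonneg _) (norm_nonneg _)).1 this
  -- The assignment `a i ↦ b i` is isometric on the span, extends to its closure `M`, and is
  -- composed with the orthogonal projection onto `M`.
  let M := (LinearMap.range A).topologicalClosure
  let e : (ι →₀ ℝ) →ₗ[ℝ] M :=
    A.codRestrict M fun f => Submodule.le_topologicalClosure _ (LinearMap.mem_range_self A f)
  have : CompleteSpace M := (Submodule.isClosed_topologicalClosure _).completeSpace_coe
  have hdense : DenseRange e := by
    intro y
    rw [closure_subtype]
    have hr : Subtype.val '' Set.range e = (LinearMap.range A : Set H) := by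
      rw [← Set.range_comp]; rfl
    rw [hr]
    exact y.2
  have hbd : ∃ C, ∀ f, ‖B f‖ ≤ C * ‖e f‖ := ⟨1, fun f => by
    rw [hAB, one_mul]; exact le_rfl⟩
  refine ⟨(B.extendOfNorm e).comp (M.orthogonalProjectionOnto), fun i => ?_⟩
  have h1 : a i = e (Finsupp.single i 1) := by simp [e, A]
  rw [ContinuousLinearMap.comp_apply, h1, Submodule.orthogonalProjectionOnto_mem_subspace_eq_self,
    LinearMap.extendOfNorm_eq hdense hbd]
  simp [B]

end FeatureMap

/-! ### Differentiability of the feature map -/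

section Differentiability

open Filter Topology
open scoped InnerProductSpace

/-- The mixed second difference of a twice continuously differentiable function of two variables
is given by a bilinear map up to a small error. -/
lemma exists_mixed_difference_le {E : Type*} [NormedAddCommGroup E] [NormedSpace ℝ E]
    {F : E × E → ℝ} (hF : ContDiff ℝ 2 F) (x y : E) :
    ∃ M : E →L[ℝ] E →L[ℝ] ℝ, ∀ ε > 0, ∃ δ > 0, ∀ h h' : E, ‖h‖ < δ → ‖h'‖ < δ →
      |F (x + h, y + h') - F (x + h, y) - F (x, y + h') + F (x, y) - M h h'| ≤
        ε * ‖h‖ * ‖h'‖ := by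
  let P : E × E → E →L[ℝ] ℝ := fun p => (fderiv ℝ F p).comp (ContinuousLinearMap.inr ℝ E E)
  have hP : ContDiff ℝ 1 P := (hF.fderiv_right (m := 1) (by norm_num)).clm_comp contDiff_const
  let A : E × E → E →L[ℝ] E →L[ℝ] ℝ := fun p =>
    (fderiv ℝ P p).comp (ContinuousLinearMap.inl ℝ E E)
  have hA : Continuous A := (hP.continuous_fderiv one_ne_zero).clm_comp continuous_const
  have hFd : ∀ u w, HasFDerivAt (fun w => F (u, w)) (P (u, w)) w := fun u w =>
    ((hF.differentiable two_ne_zero (u, w)).hasFDerivAt).comp w (hasFDerivAt_prodMk_right u w)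
  have hPd : ∀ u w, HasFDerivAt (fun u => P (u, w)) (A (u, w)) u := fun u w =>
    HasFDerivAt.comp (g := P) (f := fun u => (u, w)) u
      (hP.differentiable one_ne_zero (u, w)).hasFDerivAt (hasFDerivAt_prodMk_left u w)
  refine ⟨A (x, y), fun ε hε => ?_⟩
  obtain ⟨δ, hδ, hball⟩ :=
    (Metric.continuous_iff (β := E →L[ℝ] E →L[ℝ] ℝ)).1 hA (x, y) ε hε
  refine ⟨δ, hδ, fun h h' hh hh' => ?_⟩
  have h0 : (0 : E) ∈ Metric.ball (0 : E) δ := Metric.mem_ball_self hδ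
  -- The mean value inequality is applied twice: here to the second-variable derivative `P` as the
  -- first variable moves, then below in the second variable.
  have key : ∀ w ∈ Metric.ball (0 : E) δ,
      ‖P (x + h, y + w) - P (x, y + w) - A (x, y) h‖ ≤ ε * ‖h‖ := fun w hw => by
    have := (convex_ball (0 : E) δ).norm_image_sub_le_of_norm_hasFDerivWithin_le'
      (f := fun u => P (x + u, y + w)) (f' := fun u => A (x + u, y + w)) (φ := A (x, y)) (C := ε)
      (fun u _ => ((hPd (x + u) (y + w)).comp u ((hasFDerivAt_id u).const_add x)).hasFDerivWithinAt)
      (fun u hu => by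
        rw [← dist_eq_norm]
        refine (hball _ ?_).le
        simp only [Prod.dist_eq, dist_self_add_left, max_lt_iff]
        exact ⟨mem_ball_zero_iff.1 hu, mem_ball_zero_iff.1 hw⟩) h0 (mem_ball_zero_iff.2 hh)
    simpa using this
  have := (convex_ball (0 : E) δ).norm_image_sub_le_of_norm_hasFDerivWithin_le'
    (f := fun w => F (x + h, y + w) - F (x, y + w))
    (f' := fun w => P (x + h, y + w) - P (x, y + w)) (φ := A (x, y) h) (C := ε * ‖h‖)
    (fun w _ => (((hFd (x + h) (y + w)).comp w ((hasFDerivAt_id w).const_add y)).sub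
      ((hFd x (y + w)).comp w ((hasFDerivAt_id w).const_add y))).hasFDerivWithinAt)
    key h0 (mem_ball_zero_iff.2 hh')
  simp only [add_zero, sub_zero, Real.norm_eq_abs] at this
  convert this using 2
  ring

/-- A map into a Hilbert space is differentiable if the inner products of its values are twice
continuously differentiable. -/
lemma differentiable_of_contDiff_inner {E H : Type*} [NormedAddCommGroup E] [NormedSpace ℝ E]
    [NormedAddCommGroup H] [InnerProductSpace ℝ H] [CompleteSpace H] {k : E → H}
    (hk : ContDiff ℝ 2 fun p : E × E => ⟪k p.1, k p.2⟫_ℝ) : Differentiable ℝ k := by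
  intro x
  obtain ⟨M, hM⟩ := exists_mixed_difference_le hk x x
  let u : E → H := fun h => k (x + h) - k x
  have hu : ∀ ε > 0, ∃ δ > 0, ∀ h h' : E, ‖h‖ < δ → ‖h'‖ < δ →
      |⟪u h, u h'⟫_ℝ - M h h'| ≤ ε * ‖h‖ * ‖h'‖ := fun ε hε => by
    obtain ⟨δ, hδ, h⟩ := hM ε hε
    refine ⟨δ, hδ, fun a b ha hb => ?_⟩
    convert h a b ha hb using 2
    simp only [u, inner_sub_left, inner_sub_right]
    ring
  let l : Filter ℝ := 𝓝[≠] 0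
  let q : E → ℝ → H := fun v s => s⁻¹ • u (s • v)
  have hsmall : ∀ (v : E) (δ : ℝ), 0 < δ → ∀ᶠ s in l, s ≠ 0 ∧ ‖s • v‖ < δ := fun v δ hδ => by
    have h1 : Tendsto (fun s : ℝ => s • v) l (𝓝 0) := by
      have : Tendsto (fun s : ℝ => s • v) (𝓝 0) (𝓝 ((0 : ℝ) • v)) :=
        (continuous_id.smul continuous_const).tendsto 0
      rw [zero_smul] at this
      exact this.mono_left nhdsWithin_le_nhds
    filter_upwards [self_mem_nhdsWithin, h1 (Metric.ball_mem_nhds 0 hδ)] with s hs hs'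
    exact ⟨hs, mem_ball_zero_iff.1 hs'⟩
  have hq : ∀ ε > 0, ∃ δ > 0, ∀ (h w : E), ‖h‖ < δ → ∀ᶠ r in l,
      |⟪u h, q w r⟫_ℝ - M h w| ≤ ε * ‖h‖ * ‖w‖ := fun ε hε => by
    obtain ⟨δ, hδ, h⟩ := hu ε hε
    refine ⟨δ, hδ, fun a w ha => ?_⟩
    filter_upwards [hsmall w δ hδ] with r hr
    have h1 := h a (r • w) ha hr.2
    have h2 : ⟪u a, u (r • w)⟫_ℝ - M a (r • w) = r * (⟪u a, q w r⟫_ℝ - M a w) := by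
      simp only [q, real_inner_smul_right, map_smul, smul_eq_mul]
      field_simp [hr.1]
    rw [h2, abs_mul, norm_smul, Real.norm_eq_abs] at h1
    have h3 : 0 < |r| := abs_pos.2 hr.1
    refine le_of_mul_le_mul_left (h1.trans_eq ?_) h3
    ring
  -- The two step sizes tend to zero independently; this joint limit is what makes the difference
  -- quotients Cauchy.
  have hqq : ∀ v w : E, Tendsto (fun p : ℝ × ℝ => ⟪q v p.1, q w p.2⟫_ℝ) (l ×ˢ l)
      (𝓝 (M v w)) := fun v w => by
    rw [Metric.tendsto_nhds]
    intro ε hε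
    obtain ⟨δ, hδ, h⟩ := hu (ε / (‖v‖ * ‖w‖ + 1)) (by positivity)
    filter_upwards [(hsmall v δ hδ).prod_mk (hsmall w δ hδ)] with p hp
    have h1 := h _ _ hp.1.2 hp.2.2
    have h2 : ⟪u (p.1 • v), u (p.2 • w)⟫_ℝ - M (p.1 • v) (p.2 • w) =
        p.1 * p.2 * (⟪q v p.1, q w p.2⟫_ℝ - M v w) := by
      have := hp.1.1
      have := hp.2.1
      simp only [q, real_inner_smul_right, real_inner_smul_left, map_smul, smul_eq_mul,
        smul_apply]
      field_simp
    rw [h2, abs_mul, abs_mul, norm_smul, norm_smul, Real.norm_eq_abs, Real.norm_eq_abs] at h1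
    have h3 : 0 < |p.1| * |p.2| := mul_pos (abs_pos.2 hp.1.1) (abs_pos.2 hp.2.1)
    have h4 : |⟪q v p.1, q w p.2⟫_ℝ - M v w| ≤ ε / (‖v‖ * ‖w‖ + 1) * (‖v‖ * ‖w‖) :=
      le_of_mul_le_mul_left (h1.trans_eq (by ring)) h3
    rw [Real.dist_eq]
    refine h4.trans_lt ?_
    rw [div_mul_eq_mul_div, div_lt_iff₀ (by positivity)]
    nlinarith
  have hlim : ∀ v, ∃ Lv, Tendsto (q v) l (𝓝 Lv) := fun v => by
    have hc : Cauchy (map (q v) l) := by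
      rw [cauchy_map_iff]
      refine ⟨inferInstance, ?_⟩
      rw [tendsto_uniformity_iff_dist_tendsto_zero]
      have h1 := hqq v v
      have hfst : Tendsto (fun p : ℝ × ℝ => (p.1, p.1)) (l ×ˢ l) (l ×ˢ l) :=
        tendsto_fst.prodMk tendsto_fst
      have hsnd : Tendsto (fun p : ℝ × ℝ => (p.2, p.2)) (l ×ˢ l) (l ×ˢ l) :=
        tendsto_snd.prodMk tendsto_snd
      have h2 := (((h1.comp hfst).sub (h1.const_mul 2)).add (h1.comp hsnd)).sqrt
      have h3 : √(M v v - 2 * M v v + M v v) = 0 := by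
        rw [show M v v - 2 * M v v + M v v = 0 by ring, Real.sqrt_zero]
      rw [h3] at h2
      refine h2.congr fun p => ?_
      rw [dist_eq_norm, ← Real.sqrt_sq (norm_nonneg (q v p.1 - q v p.2)),
        norm_sub_sq_real]
      simp only [Function.comp, real_inner_self_eq_norm_sq]
    exact CompleteSpace.complete hc
  choose L hL using hlim
  have hLL : ∀ v w, ⟪L v, L w⟫_ℝ = M v w := fun v w =>
    tendsto_nhds_unique (((hL v).comp tendsto_fst).inner ((hL w).comp tendsto_snd)) (hqq v w)
  have huL : ∀ ε > 0, ∃ δ > 0, ∀ h w : E, ‖h‖ < δ →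
      |⟪u h, L w⟫_ℝ - M h w| ≤ ε * ‖h‖ * ‖w‖ := fun ε hε => by
    obtain ⟨δ, hδ, h⟩ := hq ε hε
    exact ⟨δ, hδ, fun a w ha => le_of_tendsto
      (((tendsto_const_nhds.inner (hL w)).sub tendsto_const_nhds).abs) (h a w ha)⟩
  have hadd : ∀ v w, L (v + w) = L v + L w := fun v w => by
    rw [← sub_eq_zero, ← inner_self_eq_zero (𝕜 := ℝ)]
    simp only [inner_sub_left, inner_sub_right, inner_add_left, inner_add_right, hLL, map_add,
      add_apply]
    ring
  have hsmul : ∀ (c : ℝ) v, L (c • v) = c • L v := fun c v => by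
    rw [← sub_eq_zero, ← inner_self_eq_zero (𝕜 := ℝ)]
    simp only [inner_sub_left, inner_sub_right, real_inner_smul_left, real_inner_smul_right, hLL,
      map_smul, smul_apply, smul_eq_mul]
    ring
  let L' : E →L[ℝ] H := LinearMap.mkContinuous ⟨⟨L, hadd⟩, hsmul⟩ √‖M‖ fun v => by
    refine abs_le_of_sq_le_sq' ?_ (by positivity) |>.2
    rw [mul_pow, Real.sq_sqrt (norm_nonneg M)]
    change ‖L v‖ ^ 2 ≤ _
    rw [← real_inner_self_eq_norm_sq, hLL]
    calc M v v ≤ ‖M v v‖ := Real.le_norm_self _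
      _ ≤ ‖M‖ * ‖v‖ * ‖v‖ := M.le_opNorm₂ v v
      _ = _ := by ring
  refine HasFDerivAt.differentiableAt (f' := L') ?_
  rw [hasFDerivAt_iff_isLittleO_nhds_zero, Asymptotics.isLittleO_iff]
  intro c hc
  -- In `‖u h‖² - 2⟪u h, L h⟫ + ‖L h‖²` the copies of `M h h` cancel, leaving one error from `hu`
  -- and two from `huL`, hence the thirds.
  obtain ⟨δ₁, hδ₁, h1⟩ := hu (c ^ 2 / 3) (by positivity)
  obtain ⟨δ₂, hδ₂, h2⟩ := huL (c ^ 2 / 3) (by positivity)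
  filter_upwards [Metric.ball_mem_nhds 0 hδ₁, Metric.ball_mem_nhds 0 hδ₂] with h hh1 hh2
  rw [mem_ball_zero_iff] at hh1 hh2
  have h1 := abs_le.1 (h1 h h hh1 hh1)
  have h2 := abs_le.1 (h2 h h hh2)
  refine abs_le_of_sq_le_sq' ?_ (by positivity) |>.2
  change ‖u h - L h‖ ^ 2 ≤ _
  rw [norm_sub_sq_real, ← real_inner_self_eq_norm_sq, ← real_inner_self_eq_norm_sq, hLL]
  nlinarith

end Differentiability

/-! ### The extended covariance as a Gram matrix in `ℓ²` -/

section ExtendedCovariance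

open scoped InnerProductSpace

variable {d : ℕ} {H : Type*} [NormedAddCommGroup H] [InnerProductSpace ℝ H]

/-- The value (`none`) or the `j`-th partial derivative (`some j`) of a Hilbert space valued map. -/
noncomputable def vecValueOrPartial (a : Option (Fin d)) (k : Pt d → H) (x : Pt d) : H :=
  match a with
  | none => k x
  | some j => fderiv ℝ k x (EuclideanSpace.single j 1)

lemma valueOrPartial_inner_left {k : Pt d → H} (hk : Differentiable ℝ k) (a : Option (Fin d))
    (x : Pt d) (z : H) :
    valueOrPartial a (fun u => ⟪k u, z⟫_ℝ) x = ⟪vecValueOrPartial a k x, z⟫_ℝ := by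
  cases a with
  | none => rfl
  | some j =>
    simp only [valueOrPartial, vecValueOrPartial]
    rw [fderiv_inner_apply ℝ (hk x) (differentiableAt_const z)]
    simp

lemma valueOrPartial_valueOrPartial_inner {k : Pt d → H} (hk : Differentiable ℝ k)
    (a b : Option (Fin d)) (x y : Pt d) :
    valueOrPartial a (fun u => valueOrPartial b (fun v => ⟪k u, k v⟫_ℝ) y) x =
      ⟪vecValueOrPartial a k x, vecValueOrPartial b k y⟫_ℝ := by
  rw [← valueOrPartial_inner_left hk]
  congr 1
  funext u
  rw [real_inner_comm, ← valueOrPartial_inner_left hk]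
  simp only [real_inner_comm]

/-- The value of a continuous linear functional at a derivative of `k` depends only on its values
at the points `k u` with `u ∈ X`. -/
lemma clm_fderiv_eq_fderivWithin {k : Pt d → H} (hk : Differentiable ℝ k) (c : H →L[ℝ] ℝ)
    {X : Set (Pt d)} (hX : UniqueDiffOn ℝ X) {f : Pt d → ℝ} (hf : ∀ u ∈ X, c (k u) = f u)
    {x : Pt d} (hx : x ∈ X) (v : Pt d) : c (fderiv ℝ k x v) = fderivWithin ℝ f X x v := by
  have h : HasFDerivWithinAt f (c.comp (fderiv ℝ k x)) X x :=
    ((c.hasFDerivAt.comp x (hk x).hasFDerivAt).hasFDerivWithinAt).congr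
      (fun u hu => (hf u hu).symm) (hf x hx).symm
  rw [h.fderivWithin (hX x hx)]
  rfl

lemma inner_vecValueOrPartial_eq_zero {k : Pt d → H} (hk : Differentiable ℝ k)
    {X : Set (Pt d)} (hX : UniqueDiffOn ℝ X) {z : H} (hz : ∀ u ∈ X, ⟪z, k u⟫_ℝ = 0)
    (a : Option (Fin d)) {x : Pt d} (hx : x ∈ X) : ⟪z, vecValueOrPartial a k x⟫_ℝ = 0 := by
  cases a with
  | none => exact hz x hx
  | some j =>
    have := clm_fderiv_eq_fderivWithin hk (innerSL ℝ z) hX (f := fun _ => 0) (by simpa using hz) hx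
      (EuclideanSpace.single j 1)
    simpa [vecValueOrPartial] using this

/-- A continuous linear map that preserves the inner products of the values of `k` on `X` preserves
those of its partial derivatives too. -/
lemma inner_map_vecValueOrPartial [CompleteSpace H] {H' : Type*} [NormedAddCommGroup H']
    [InnerProductSpace ℝ H'] [CompleteSpace H'] {k : Pt d → H} (hk : Differentiable ℝ k)
    {X : Set (Pt d)} (hX : UniqueDiffOn ℝ X) (T : H →L[ℝ] H')
    (hT : ∀ x ∈ X, ∀ y ∈ X, ⟪T (k x), T (k y)⟫_ℝ = ⟪k x, k y⟫_ℝ)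
    (a b : Option (Fin d)) {x y : Pt d} (hx : x ∈ X) (hy : y ∈ X) :
    ⟪T (vecValueOrPartial a k x), T (vecValueOrPartial b k y)⟫_ℝ =
      ⟪vecValueOrPartial a k x, vecValueOrPartial b k y⟫_ℝ := by
  -- The defect is the form of `T* T - 1`. Its vanishing passes from values to derivatives in one
  -- argument at a time.
  have hadj : ∀ u v, ⟪T u, T v⟫_ℝ - ⟪u, v⟫_ℝ = ⟪T.adjoint (T u) - u, v⟫_ℝ := fun u v => by
    rw [inner_sub_left, ContinuousLinearMap.adjoint_inner_left]
  have h1 : ∀ v ∈ X, ⟪T.adjoint (T (vecValueOrPartial a k x)) - vecValueOrPartial a k x, k v⟫_ℝ = 0 :=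
    fun v hv => by
      rw [← hadj, real_inner_comm, real_inner_comm (k v), hadj]
      refine inner_vecValueOrPartial_eq_zero hk hX (fun u hu => ?_) a hx
      rw [← hadj, hT v hv u hu, sub_self]
  rw [← sub_eq_zero, hadj]
  exact inner_vecValueOrPartial_eq_zero hk hX h1 b hy

/-- The entries of the extended covariance matrix are inner products of vectors in `ℓ²` whose
coordinates are the scaled eigenfunctions and their partial derivatives. -/
lemma exists_extCov_features {X : Set (Pt d)} (hX : UniqueDiffOn ℝ X) {K : Pt d → Pt d → ℝ}
    (hK : IsPSDKernel K) (hK2 : ContDiff ℝ 2 (fun p : Pt d × Pt d => K p.1 p.2))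
    {S : Type*} {lam : S → ℝ} (hlam : ∀ s, 0 ≤ lam s) {φ : S → Pt d → ℝ}
    (hexp : ∀ x ∈ X, ∀ y ∈ X, HasSum (fun s => lam s * φ s x * φ s y) (K x y)) :
    ∃ w : Option (Fin d) → Pt d → lp (fun _ : S => ℝ) 2,
      (∀ a b, ∀ x ∈ X, ∀ y ∈ X, ⟪w a x, w b y⟫_ℝ =
        valueOrPartial a (fun u => valueOrPartial b (fun v => K u v) y) x) ∧
      ∀ s, ∀ x ∈ X, ∑ a, (w a x s) ^ 2 = lam s * extSq X (φ s) x := by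
  obtain ⟨H, _, _, _, k, hk⟩ := exists_featureMap hK
  have hkd : Differentiable ℝ k := differentiable_of_contDiff_inner (by simpa only [hk] using hK2)
  have hmem : ∀ x : X, Memℓp (fun s => √(lam s) * φ s x) 2 := fun x => by
    refine memℓp_gen ?_
    refine (hexp x x.2 x x.2).summable.congr fun s => ?_
    simp [mul_pow, Real.sq_sqrt (hlam s)]
    ring
  let Φ : X → lp (fun _ : S => ℝ) 2 := fun x => ⟨_, hmem x⟩
  have hΦ : ∀ x y : X, ⟪k x, k y⟫_ℝ = ⟪Φ x, Φ y⟫_ℝ := fun x y => by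
    rw [hk]
    have h : HasSum (fun s => √(lam s) * φ s y * (√(lam s) * φ s x)) ⟪Φ x, Φ y⟫_ℝ :=
      lp.hasSum_inner (Φ x) (Φ y)
    have he : (fun s => lam s * φ s x * φ s y) =
        fun s => √(lam s) * φ s y * (√(lam s) * φ s x) := by
      funext s
      linear_combination -(φ s x * φ s y) * Real.mul_self_sqrt (hlam s)
    exact (he ▸ hexp x x.2 y y.2).unique h
  obtain ⟨T, hT⟩ := exists_clm_of_inner_eq (fun x : X => k x) Φ hΦ
  refine ⟨fun a x => T (vecValueOrPartial a k x), fun a b x hx y hy => ?_, fun s x hx => ?_⟩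
  · rw [inner_map_vecValueOrPartial hkd hX T (fun x hx y hy => ?_) a b hx hy,
      ← valueOrPartial_valueOrPartial_inner hkd]
    · simp only [hk]
    · rw [hT ⟨x, hx⟩, hT ⟨y, hy⟩, hΦ ⟨x, hx⟩ ⟨y, hy⟩]
  · let c : H →L[ℝ] ℝ := (lp.evalCLM ℝ (fun _ : S => ℝ) 2 s).comp T
    have hc : ∀ u ∈ X, c (k u) = √(lam s) * φ s u := fun u hu => by
      change (T (k u)) s = _
      rw [hT ⟨u, hu⟩]
    have hj : ∀ j, T (vecValueOrPartial (some j) k x) s =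
        √(lam s) * fderivWithin ℝ (φ s) X x (EuclideanSpace.single j 1) := fun j => by
      have := clm_fderiv_eq_fderivWithin hkd c hX hc hx (EuclideanSpace.single j 1)
      refine Eq.trans this ?_
      -- No differentiability of `φ s` is available when `lam s = 0`; both sides then vanish.
      have h := fderivWithin_const_smul_field (f := φ s) (√(lam s)) (hX x hx)
      exact DFunLike.congr_fun h _
    rw [Fintype.sum_option]
    simp only [hj]
    rw [show T (vecValueOrPartial none k x) s = √(lam s) * φ s x from hc x hx]
    simp only [mul_pow, Real.sq_sqrt (hlam s), extSq, mul_add, Finset.mul_sum]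

end ExtendedCovariance

/-! ### The `1 - e⁻¹` guarantee for greedy increments -/

section Greedy

open Matrix

/-- The gain in `log det (1 + ·)` from several increments is at most the sum of their single
gains. -/
lemma log_det_add_sum_sub_le {m ι : Type*} [Fintype m] [DecidableEq m] {W : Matrix m m ℝ}
    (hW : W.PosDef) {o : ι → Matrix m m ℝ} (ho : ∀ l, (o l).PosSemidef) (s : Finset ι) :
    Real.log (W + ∑ l ∈ s, o l).det - Real.log W.det ≤
      ∑ l ∈ s, (Real.log (W + o l).det - Real.log W.det) := by
  classical
  induction s using Finset.induction_on with
  | empty => simp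
  | insert l s hl ih =>
    have h := log_det_submodular hW (posSemidef_sum s fun l _ => ho l) (ho l)
    rw [Finset.sum_insert hl, Finset.sum_insert hl, add_comm (o l), ← add_assoc]
    linarith

/-- The greedy guarantee: if each increment `b τ` gains at least as much as each `o l` would, then
`t` greedy increments reach the fraction `1 - e⁻¹` of the gain of all the `o l`. -/
lemma log_det_le_of_greedy {m : Type*} [Fintype m] [DecidableEq m] {t : ℕ}
    {b o : Fin t → Matrix m m ℝ} (hb : ∀ r, (b r).PosSemidef) (ho : ∀ l, (o l).PosSemidef)
    (hgreedy : ∀ τ l, Real.log (1 + (∑ r ∈ Finset.Iio τ, b r + o l)).det ≤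
      Real.log (1 + ∑ r ∈ Finset.Iic τ, b r).det) :
    Real.log (1 + ∑ l, o l).det ≤
      (1 - Real.exp (-1))⁻¹ * Real.log (1 + ∑ r, b r).det := by
  set M := Real.log (1 + ∑ l, o l).det with hM
  let a : ℕ → ℝ := fun j => Real.log (1 + ∑ r with r.val < j, b r).det
  have hat : a t = Real.log (1 + ∑ r, b r).det := by
    simp only [a, Fin.is_lt, Finset.filter_true]
  have hM0 : 0 ≤ M := by
    simpa using log_det_le_log_det_add (PosDef.one (n := m) (R := ℝ))
      (posSemidef_sum Finset.univ fun l _ => ho l)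
  -- By monotonicity and submodularity, the `t` single gains of the `o l` on top of the current sum
  -- cover `M - a τ`; each is at most the greedy gain.
  have hstep : ∀ τ : Fin t, M ≤ a τ + t * (a (τ + 1) - a τ) := fun τ => by
    have hG : (∑ r with r.val < τ.val, b r).PosSemidef := posSemidef_sum _ fun r _ => hb r
    have h1 : M ≤ Real.log (1 + ∑ r with r.val < τ.val, b r + ∑ l, o l).det := by
      rw [add_right_comm]
      exact log_det_le_log_det_add
        (PosDef.one.add_posSemidef (posSemidef_sum Finset.univ fun l _ => ho l)) hG
    have h2 := log_det_add_sum_sub_le (PosDef.one.add_posSemidef hG) ho Finset.univ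
    have h3 : ∑ l, (Real.log (1 + ∑ r with r.val < τ.val, b r + o l).det - a τ) ≤
        ∑ _l : Fin t, (a (τ + 1) - a τ) := by
      refine Finset.sum_le_sum fun l _ => sub_le_sub_right ?_ _
      have e1 : Finset.Iio τ = Finset.univ.filter fun r : Fin t => r.val < τ.val := by
        ext r; simp
      have e2 : Finset.Iic τ = Finset.univ.filter fun r : Fin t => r.val < τ.val + 1 := by
        ext r; simp
      have := hgreedy τ l
      rw [e1, e2, ← add_assoc] at this
      exact this
    rw [Finset.sum_const, Finset.card_univ, Fintype.card_fin, nsmul_eq_mul] at h3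
    change _ - a τ ≤ _ at h2
    linarith
  rw [← hat]
  rcases Nat.eq_zero_or_pos t with rfl | ht
  · simp [hM, a]
  have ht' : (0 : ℝ) < t := Nat.cast_pos.2 ht
  have ht1 : (1 : ℝ) ≤ t := Nat.one_le_cast.2 ht
  -- Each round thus shrinks the remaining gap by a factor `1 - 1 / t`.
  have hind : ∀ j ≤ t, M - a j ≤ (1 - 1 / t) ^ j * M := fun j => by
    induction j with
    | zero => intro _; simp [a]
    | succ j ih =>
      intro hj
      have h1 := hstep ⟨j, hj⟩
      have h2 := ih (by omega)
      simp only at h1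
      have h0 : 0 ≤ 1 - 1 / (t : ℝ) := by
        rw [sub_nonneg, div_le_one ht']; exact ht1
      have h3 : M - a (j + 1) ≤ (1 - 1 / t) * (M - a j) := by
        have : (M - a j) / t ≤ a (j + 1) - a j := by
          rw [div_le_iff₀ ht']; linarith
        have e : (1 - 1 / (t : ℝ)) * (M - a j) = (M - a j) - (M - a j) / t := by ring
        rw [e]; linarith
      calc _ ≤ _ := h3
        _ ≤ (1 - 1 / t) * ((1 - 1 / t) ^ j * M) := mul_le_mul_of_nonneg_left h2 h0
        _ = _ := by ring
  have h1 := hind t le_rfl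
  have h2 : (1 - 1 / (t : ℝ)) ^ t ≤ Real.exp (-1) := Real.one_sub_div_pow_le_exp_neg ht1
  have h3 := mul_le_mul_of_nonneg_right h2 hM0
  have h4 : 0 < 1 - Real.exp (-1) := by
    rw [sub_pos, Real.exp_lt_one_iff]; norm_num
  rw [inv_mul_eq_div, le_div_iff₀ h4]
  linarith

end Greedy

/-! ### Bounds for the information gain -/

section InfoGain

open Matrix

variable {d : ℕ}

lemma infoGain_eq (K : Pt d → Pt d → ℝ) (σ : ℝ) {κ : Type*} [Fintype κ] [DecidableEq κ]
    (x : κ → Pt d) :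
    infoGain K σ x = (1 / 2) * Real.log (1 + (σ ^ 2)⁻¹ • extCov K x).det := by
  unfold infoGain
  congr!

/-- The information gain at points chosen from a finite family is the logarithm of the determinant
of a sum of positive semidefinite matrices, one for each point. -/
lemma exists_infoGain_eq_log_det_sum {K : Pt d → Pt d → ℝ} {σ : ℝ} {κ₀ : Type*} [Fintype κ₀]
    {x₀ : κ₀ → Pt d} (h : (extCov K x₀).PosSemidef) :
    ∃ (N : ℕ) (Q : κ₀ → Matrix (Fin N) (Fin N) ℝ), (∀ p, (Q p).PosSemidef) ∧
      ∀ {κ : Type} [Fintype κ] (f : κ → κ₀),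
        infoGain K σ (fun i => x₀ (f i)) = (1 / 2) * Real.log (1 + ∑ i, Q (f i)).det := by
  classical
  obtain ⟨N, u, hu⟩ := exists_eq_sum_vecMulVec (h.smul (inv_nonneg.2 (sq_nonneg σ)))
  refine ⟨N, fun p => ∑ a : Option (Fin d), vecMulVec (fun i => u i (p, a)) (fun i => u i (p, a)),
    fun p => posSemidef_sum_vecMulVec _ _, fun {κ} _ f => ?_⟩
  -- Sylvester's identity exchanges `D * Dᵀ`, whose size depends on the number of points, for `Dᵀ *
  -- D` of fixed size `N`, which is additive over the points.
  let D : Matrix (κ × Option (Fin d)) (Fin N) ℝ := Matrix.of fun q i => u i (f q.1, q.2)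
  have h1 : (σ ^ 2)⁻¹ • extCov K (fun i => x₀ (f i)) = D * Dᵀ := by
    ext p q
    have := congrFun (congrFun hu (f p.1, p.2)) (f q.1, q.2)
    rw [Matrix.sum_apply] at this
    change (σ ^ 2)⁻¹ * extCov K x₀ (f p.1, p.2) (f q.1, q.2) = _
    simpa [D, Matrix.mul_apply, vecMulVec_apply] using this
  have h2 : Dᵀ * D = ∑ i : κ, ∑ a : Option (Fin d),
      vecMulVec (fun j => u j (f i, a)) (fun j => u j (f i, a)) := by
    ext j j'
    simp [D, Matrix.mul_apply, Matrix.sum_apply, vecMulVec_apply, Fintype.sum_prod_type]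
  rw [infoGain_eq, h1, det_one_add_mul_comm, h2]

variable {X : Set (Pt d)} {K : Pt d → Pt d → ℝ} {σ : ℝ} {S : Type*} {lam : S → ℝ}
  {φ : S → Pt d → ℝ} {w : Option (Fin d) → Pt d → lp (fun _ : S => ℝ) 2}

lemma extCov_posSemidef {κ : Type*} [Fintype κ] {x : κ → Pt d} (hx : ∀ i, x i ∈ X)
    (hw : ∀ a b, ∀ x ∈ X, ∀ y ∈ X, inner ℝ (w a x) (w b y) =
      valueOrPartial a (fun u => valueOrPartial b (fun v => K u v) y) x) :
    (extCov K x).PosSemidef := by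
  have : extCov K x = gram ℝ (fun p : κ × Option (Fin d) => w p.2 (x p.1)) := by
    ext p q
    exact (hw p.2 q.2 _ (hx p.1) _ (hx q.1)).symm
  rw [this]
  exact posSemidef_gram ℝ _

lemma boundTerm_eq_log_one_add_dotProduct {κ : Type*} [Fintype κ] {x : κ → Pt d}
    (hx : ∀ i, x i ∈ X)
    (hsq : ∀ s, ∀ x ∈ X, ∑ a, (w a x s) ^ 2 = lam s * extSq X (φ s) x) (s : S) :
    boundTerm X σ lam φ x s = Real.log (1 +
      (fun p : κ × Option (Fin d) => σ⁻¹ * w p.2 (x p.1) s) ⬝ᵥ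
        fun p : κ × Option (Fin d) => σ⁻¹ * w p.2 (x p.1) s) := by
  rw [boundTerm]
  congr 2
  simp only [dotProduct, Fintype.sum_prod_type]
  rw [mul_assoc, Finset.mul_sum, Finset.mul_sum]
  refine Finset.sum_congr rfl fun i _ => ?_
  rw [← hsq s _ (hx i), Finset.mul_sum]
  exact Finset.sum_congr rfl fun a _ => by ring

/-- Since `log (1 + r) ≤ r`, the terms are dominated by a finite sum of scaled squared `ℓ²`
coordinates. -/
lemma summable_boundTerm {κ : Type*} [Fintype κ] {x : κ → Pt d} (hx : ∀ i, x i ∈ X)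
    (hsq : ∀ s, ∀ x ∈ X, ∑ a, (w a x s) ^ 2 = lam s * extSq X (φ s) x) :
    Summable (boundTerm X σ lam φ x) := by
  have hs : Summable fun s => (fun p : κ × Option (Fin d) => σ⁻¹ * w p.2 (x p.1) s) ⬝ᵥ
      fun p : κ × Option (Fin d) => σ⁻¹ * w p.2 (x p.1) s := by
    refine summable_sum fun p _ => ?_
    have := (lp.summable_inner (𝕜 := ℝ) (w p.2 (x p.1)) (w p.2 (x p.1))).mul_left (σ⁻¹ * σ⁻¹)
    refine this.congr fun s => ?_
    change _ * (w p.2 (x p.1) s * w p.2 (x p.1) s) = _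
    ring
  have hnn : ∀ s, 0 ≤ (fun p : κ × Option (Fin d) => σ⁻¹ * w p.2 (x p.1) s) ⬝ᵥ
      fun p : κ × Option (Fin d) => σ⁻¹ * w p.2 (x p.1) s := fun s =>
    Finset.sum_nonneg fun p _ => mul_self_nonneg _
  refine Summable.of_nonneg_of_le (fun s => ?_) (fun s => ?_) hs
  · rw [boundTerm_eq_log_one_add_dotProduct hx hsq]
    exact Real.log_nonneg (le_add_of_nonneg_right (hnn s))
  · rw [boundTerm_eq_log_one_add_dotProduct hx hsq]
    have := Real.log_le_sub_one_of_pos (add_pos_of_pos_of_nonneg one_pos (hnn s))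
    linarith

lemma infoGain_le_tsum_boundTerm {κ : Type*} [Fintype κ] {x : κ → Pt d} (hx : ∀ i, x i ∈ X)
    (hw : ∀ a b, ∀ x ∈ X, ∀ y ∈ X, inner ℝ (w a x) (w b y) =
      valueOrPartial a (fun u => valueOrPartial b (fun v => K u v) y) x)
    (hsq : ∀ s, ∀ x ∈ X, ∑ a, (w a x s) ^ 2 = lam s * extSq X (φ s) x) :
    infoGain K σ x ≤ (1 / 2) * ∑' s, boundTerm X σ lam φ x s := by
  classical
  have hsum := summable_boundTerm (σ := σ) hx hsq
  rw [infoGain_eq]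
  rw [funext (boundTerm_eq_log_one_add_dotProduct (σ := σ) hx hsq)] at hsum ⊢
  refine mul_le_mul_of_nonneg_left (log_det_one_add_le_tsum ?_ hsum) (by norm_num)
  refine Pi.hasSum.2 fun p => Pi.hasSum.2 fun q => ?_
  have := (lp.hasSum_inner (𝕜 := ℝ) (w p.2 (x p.1)) (w q.2 (x q.1))).mul_left (σ⁻¹ * σ⁻¹)
  rw [hw _ _ _ (hx _) _ (hx _)] at this
  have h1 : (fun s => σ⁻¹ * σ⁻¹ * inner ℝ (w p.2 (x p.1) s) (w q.2 (x q.1) s)) =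
      fun s => vecMulVec (fun p : κ × Option (Fin d) => σ⁻¹ * w p.2 (x p.1) s)
        (fun p : κ × Option (Fin d) => σ⁻¹ * w p.2 (x p.1) s) p q := by
    funext s
    change σ⁻¹ * σ⁻¹ * (w q.2 (x q.1) s * w p.2 (x p.1) s) = _
    rw [vecMulVec_apply]
    ring
  rw [h1, ← mul_inv, ← sq] at this
  exact this

/-- Points collected greedily in batches reach the fraction `1 - e⁻¹` of the information gain of
every set of as many points. -/
lemma infoGainSet_le_of_isGreedy
    (hw : ∀ a b, ∀ x ∈ X, ∀ y ∈ X, inner ℝ (w a x) (w b y) =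
      valueOrPartial a (fun u => valueOrPartial b (fun v => K u v) y) x)
    {n t : ℕ} {x : Fin t → Fin n → Pt d} (hx : IsGreedy K σ X x) {A : Finset (Pt d)}
    (hA : (A : Set (Pt d)) ⊆ X) (hcard : A.card = n * t) :
    infoGainSet K σ A ≤
      (1 - Real.exp (-1))⁻¹ * infoGain K σ (fun p : Fin t × Fin n => x p.1 p.2) := by
  -- An arbitrary splitting of `A` into `t` batches of `n`; each one competes with every greedy
  -- batch. Joining the greedy points and `A` in `x₀` gives all gains matrices of one size.
  let e : Fin t × Fin n ≃ A := Fintype.equivOfCardEq (by simp [hcard, mul_comm])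
  let x₀ : (Fin t × Fin n) ⊕ A → Pt d := Sum.elim (fun p => x p.1 p.2) (fun a => a)
  have hx₀ : ∀ p, x₀ p ∈ X := by
    rintro (p | a)
    · exact hx.1 _ _
    · exact hA a.2
  obtain ⟨N, Q, hQ, hgain⟩ := exists_infoGain_eq_log_det_sum (σ := σ) (extCov_posSemidef hx₀ hw)
  have hA' : infoGainSet K σ A =
      (1 / 2) * Real.log (1 + ∑ l, ∑ i, Q (Sum.inr (e (l, i)))).det := by
    rw [← Fintype.sum_prod_type' fun l i => Q (Sum.inr (e (l, i))),
      Equiv.sum_comp e fun a => Q (Sum.inr a)]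
    exact hgain Sum.inr
  have hx' : infoGain K σ (fun p : Fin t × Fin n => x p.1 p.2) =
      (1 / 2) * Real.log (1 + ∑ r, ∑ i, Q (Sum.inl (r, i))).det := by
    rw [← Fintype.sum_prod_type' fun r i => Q (Sum.inl (r, i))]
    exact hgain Sum.inl
  have hgreedy : ∀ τ l, Real.log (1 + (∑ r ∈ Finset.Iio τ, ∑ i, Q (Sum.inl (r, i)) +
      ∑ i, Q (Sum.inr (e (l, i))))).det ≤
      Real.log (1 + ∑ r ∈ Finset.Iic τ, ∑ i, Q (Sum.inl (r, i))).det := fun τ l => by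
    have h := hx.2 τ (fun i => e (l, i)) fun i => hA (e (l, i)).2
    have h1 := hgain fun p : {r : Fin t // r ≤ τ} × Fin n => Sum.inl (p.1.1, p.2)
    -- Index form of replacing batch `τ` by the `l`-th batch of `A`.
    let f : {r : Fin t // r ≤ τ} × Fin n → (Fin t × Fin n) ⊕ A := fun p =>
      if p.1.1 = τ then Sum.inr (e (l, p.2)) else Sum.inl (p.1.1, p.2)
    have hf : (fun p : {r : Fin t // r ≤ τ} × Fin n =>
        Function.update x τ (fun i => (e (l, i) : Pt d)) p.1.1 p.2) = fun p => x₀ (f p) := by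
      funext p
      by_cases hp : p.1.1 = τ
      · simp [f, hp, x₀]
      · simp [f, hp, x₀]
    rw [hf, hgain f] at h
    have h' := h.trans_eq h1
    have e1 : ∀ F : Fin t → Fin n → Matrix (Fin N) (Fin N) ℝ,
        ∑ p : {r : Fin t // r ≤ τ} × Fin n, F p.1.1 p.2 = ∑ r ∈ Finset.Iic τ, ∑ i, F r i :=
      fun F => by
        rw [Fintype.sum_prod_type' fun (r : {r : Fin t // r ≤ τ}) i => F r.1 i]
        exact (Finset.sum_subtype _ (by simp) fun r => ∑ i, F r i).symm
    have e2 : ∑ p, Q (f p) = ∑ r ∈ Finset.Iio τ, ∑ i, Q (Sum.inl (r, i)) +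
        ∑ i, Q (Sum.inr (e (l, i))) := by
      have := e1 fun r i => Q (if r = τ then Sum.inr (e (l, i)) else Sum.inl (r, i))
      refine this.trans ?_
      rw [← Finset.Iio_insert, Finset.sum_insert (by simp), add_comm]
      congr 1
      · refine Finset.sum_congr rfl fun r hr => ?_
        simp [(Finset.mem_Iio.1 hr).ne]
      · simp
    rw [e2, e1 fun r i => Q (Sum.inl (r, i))] at h'
    linarith
  have := log_det_le_of_greedy (fun r => posSemidef_sum _ fun i _ => hQ _)
    (fun l => posSemidef_sum _ fun i _ => hQ _) hgreedy
  rw [hA', hx']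
  linarith

end InfoGain

end GPD

/-! ### Conclusion -/

theorem mainTheorem3 {d : ℕ} (X : Set (GPD.Pt d)) (hX : UniqueDiffOn ℝ X)
    (K : GPD.Pt d → GPD.Pt d → ℝ) (hK : GPD.IsPSDKernel K)
    (hK2 : ContDiff ℝ 2 (fun p : GPD.Pt d × GPD.Pt d => K p.1 p.2))
    (μ : MeasureTheory.Measure (GPD.Pt d)) [MeasureTheory.IsFiniteMeasure μ]
    {S : Type*} (lam : S → ℝ) (φ : S → GPD.Pt d → ℝ)
    (hM : GPD.IsMercerExpansion X μ K lam φ)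
    (σ : ℝ) (hσ : 0 < σ) (n t : ℕ) :
    -- the series in the bound converges for all points of the domain
    (∀ (N : ℕ) (x : Fin N → GPD.Pt d), (∀ i, x i ∈ X) →
      Summable (GPD.boundTerm X σ lam φ x)) ∧
    -- the bound for the information gain of every set of points
    (∀ A : Finset (GPD.Pt d), (A : Set (GPD.Pt d)) ⊆ X → A.card = n * t →
      GPD.infoGainSet K σ A ≤ GPD.mercerBound X σ lam φ (fun a : A => (a : GPD.Pt d))) ∧
    -- the bound for the maximum information gain, at points that attain the maximum
    (∀ A : Finset (GPD.Pt d), (A : Set (GPD.Pt d)) ⊆ X → A.card = n * t →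
      (GPD.infoGainSet K σ A : EReal) = GPD.maxInfoGain K σ X (n * t) →
      GPD.maxInfoGain K σ X (n * t) ≤
        (GPD.mercerBound X σ lam φ (fun a : A => (a : GPD.Pt d)) : EReal)) ∧
    -- the bound for the maximum information gain, at points collected greedily in batches
    (∀ x : Fin t → Fin n → GPD.Pt d, GPD.IsGreedy K σ X x →
      GPD.maxInfoGain K σ X (n * t) ≤
        (GPD.mercerBound X σ lam φ (fun p : Fin t × Fin n => x p.1 p.2) : EReal)) := by
  obtain ⟨w, hw, hsq⟩ := GPD.exists_extCov_features hX hK hK2 hM.nonneg hM.expansion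
  have he : 0 < 1 - Real.exp (-1) := by
    rw [sub_pos, Real.exp_lt_one_iff]; norm_num
  have hc : 1 ≤ (1 - Real.exp (-1))⁻¹ :=
    (one_le_inv₀ he).2 (by linarith [Real.exp_pos (-1)])
  have hset : ∀ A : Finset (GPD.Pt d), (A : Set (GPD.Pt d)) ⊆ X →
      GPD.infoGainSet K σ A ≤ GPD.mercerBound X σ lam φ (fun a : A => (a : GPD.Pt d)) := by
    intro A hA
    have hx : ∀ a : A, (a : GPD.Pt d) ∈ X := fun a => hA a.2
    have h0 : 0 ≤ ∑' s, GPD.boundTerm X σ lam φ (fun a : A => (a : GPD.Pt d)) s :=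
      tsum_nonneg fun s => by
        rw [GPD.boundTerm_eq_log_one_add_dotProduct hx hsq]
        exact Real.log_nonneg (le_add_of_nonneg_right
          (Finset.sum_nonneg fun p _ => mul_self_nonneg _))
    refine (GPD.infoGain_le_tsum_boundTerm hx hw hsq).trans ?_
    -- For a set the constant `1 / 2` already suffices; `c ≥ 1` only weakens the bound.
    exact mul_le_mul_of_nonneg_right (by linarith) h0
  refine ⟨fun N x hx => GPD.summable_boundTerm hx hsq, fun A hA _ => hset A hA,
    fun A hA _ hmax => ?_, fun x hx => iSup_le fun A => ?_⟩
  · rw [← hmax]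
    exact EReal.coe_le_coe_iff.2 (hset A hA)
  · refine EReal.coe_le_coe_iff.2
      ((GPD.infoGainSet_le_of_isGreedy hw hx A.2.1 A.2.2).trans ?_)
    have h := GPD.infoGain_le_tsum_boundTerm (σ := σ)
      (x := fun p : Fin t × Fin n => x p.1 p.2) (fun p => hx.1 p.1 p.2) hw hsq
    refine (mul_le_mul_of_nonneg_left h (by linarith)).trans_eq ?_
    rw [GPD.mercerBound]
    ring
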